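/- Write points of $\mathbb{R}^n$ ($n\ge 1$) as $x=(x',x_n)$ with $x'\in\mathbb{R}^{n-1}$, and let $B_1^+=\{x\in\mathbb{R}^n:\ |x|<1,\ x_n>0\}$. For every $n$ and every $\alpha>\frac15$ there is $\alpha'>0$, depending only on $n$ and $\alpha$, such that for all $\lambda,\Lambda,\mu,\rho>0$ there are constants $c,C>0$, depending only on $n,\lambda,\Lambda,\mu,\alpha,\rho$, with the following property. Let $f$ be measurable with $\lambda\le f\le\Lambda$ a.e. in $B_1^+$, and let $u:\overline{B_1^+}\to\mathbb{R}$ be a convex, continuous solution (in the sense of Alexandrov: $|\partial u(E)|=\int_E f\,dx$ for every Borel set $E\subset B_1^+$) of $$\det D^2u=f\ \text{ in } B_1^+,\qquad u=\varphi\ \text{ on }\partial B_1^+,$$ with $u(0)=0$ and $\nabla u(0)=0$. The latter means that $u\ge 0$ on $\overline{B_1^+}$, while for no $\varepsilon>0$ does $u(x)\ge\varepsilon x_n$ hold for all $x\in\overline{B_1^+}$. Assume that $$\varphi(x',0)\le\mu^{-1}|x'|^{1+\alpha}\quad\text{for } |x'|<\tfrac12,\qquad\text{and}\qquad \varphi(x)\ge\mu|x|^2\quad\text{on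 }\partial B_1^+\cap\{x_n\le\rho\}.$$ Then $$u(x)\le C|x|^{1+\alpha'}\quad\text{for every } x\in B_1^+ \text{ with } u(x)\le c.$$ -/

import Mathlib

open MeasureTheory

/-- The open upper half ball `B₁⁺ = {x ∈ ℝⁿ : |x| < 1, xₙ > 0}`, where `n = m + 1` and `xₙ` is the
last coordinate. -/
def upperHalfBall (m : ℕ) : Set (EuclideanSpace ℝ (Fin (m + 1))) :=
  {x | ‖x‖ < 1 ∧ 0 < x (Fin.last m)}

/-- The horizontal part `x' = (x₁, …, xₙ₋₁)` of `x = (x', xₙ)`. -/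
def horizontalPart {m : ℕ} (x : EuclideanSpace ℝ (Fin (m + 1))) : EuclideanSpace ℝ (Fin m) :=
  WithLp.toLp 2 (fun i => x i.castSucc)

/-- The subdifferential `∂u(x)`, relative to `Ω`: all slopes of affine functions which touch
the graph of `u` from below over `Ω` at `x`. -/
def subdifferentialOn {n : ℕ} (Ω : Set (EuclideanSpace ℝ (Fin n)))
    (u : EuclideanSpace ℝ (Fin n) → ℝ) (x : EuclideanSpace ℝ (Fin n)) :
    Set (EuclideanSpace ℝ (Fin n)) :=
  {p | ∀ y ∈ Ω, u x + inner ℝ p (y - x) ≤ u y}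

/-- `u` is a convex solution, continuous on the closure of `Ω`, of the Dirichlet problem
`det D²u = f` in `Ω`, `u = φ` on `∂Ω`, in the sense of Alexandrov: the Monge–Ampère measure
`E ↦ |∂u(E)|` of `u` has density `f` with respect to Lebesgue measure. Only the values of `u` on
the closure of `Ω`, of `φ` on the boundary and of `f` in `Ω` matter. -/
structure IsMongeAmpereSolution {n : ℕ} (Ω : Set (EuclideanSpace ℝ (Fin n)))
    (f φ u : EuclideanSpace ℝ (Fin n) → ℝ) : Prop where
  convexOn : ConvexOn ℝ (closure Ω) u
  continuousOn : ContinuousOn u (closure Ω)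
  volume_subdifferential : ∀ E : Set (EuclideanSpace ℝ (Fin n)), MeasurableSet E → E ⊆ Ω →
    volume (⋃ x ∈ E, subdifferentialOn Ω u x) = ∫⁻ x in E, ENNReal.ofReal (f x)
  boundary : ∀ x ∈ frontier Ω, u x = φ x

/-- `∇u(x₀) = p` at a boundary point `x₀` of `Ω` with unit inner normal `ν`: the affine function
`u(x₀) + p · (x - x₀)` supports the graph of `u` over the closure of `Ω`, but
`u(x₀) + (p + ε ν) · (x - x₀)` does not for any `ε > 0`. -/
def IsBoundaryGradient {n : ℕ} (Ω : Set (EuclideanSpace ℝ (Fin n)))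
    (u : EuclideanSpace ℝ (Fin n) → ℝ) (x₀ ν p : EuclideanSpace ℝ (Fin n)) : Prop :=
  p ∈ subdifferentialOn (closure Ω) u x₀ ∧
    ∀ ε : ℝ, 0 < ε → p + ε • ν ∉ subdifferentialOn (closure Ω) u x₀

/-!
Only quadratic barriers are used. If `det D²u ≤ Λ` and a quadratic `b` with `det D²b > Λ` lies below
`u` on the boundary of a section, then it lies below `u` inside, since otherwise the gradient
image of `{u < b}` would be too large (`quadratic_le_of_volume_subdifferential_le`). One such barrier
on the whole half ball gives `u ≥ μ |x'|² - K xₙ`.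

Suppose `u(y) > h = s ^ (1 + θ)` at a point with `|y| = s`, with `s` small. The flat disc of radius
`r = (μ h) ^ (1 / (1 + α))` lies in `{u ≤ h}`, and `r` is much larger than `s`. By convexity,
`xₙ ≤ β max(u, h) + γ |x'|`, where `β = 4 s / h` is of order
`s ^ (-θ)`, while `γ = 4 s / r` is so small that it absorbs a given power of `β` if `θ` is small
(`last_le_of_lt_apply`).

The main point is that then `max(u, h) ≥ κ |x'|²` in the whole half ball, with `κ` of order
`β⁻¹` (`quadratic_le_max`). At a point `z` with `|z'| = d` maximal among those where this
fails, the affine function `L = μ z' · x' - μ d² / 4` lies below `u` on the flat boundary and exceeds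
`u(z)` by at least `μ d² / 2`. By maximality of `d` the section `{u ≤ L}` has width of order `β d`,
hence height of order `β² γ d`. Its depth is of order at least `d²`, which the bound
on `det D²u` excludes for a convex set of volume much less than `d ^ n`.

Consequently `{u ≤ h}` has width at most `(h / κ) ^ (1 / 2)` and height at most
`β h + γ (h / κ) ^ (1 / 2)`, so that its volume is much less than `h ^ (n / 2)`. A last barrier gives
`u ≥ ε xₙ` for some `ε > 0` (`exists_linear_le`), against `∇u(0) = 0`. Hence `u ≤ |x| ^ (1 + θ)` near
the origin.
-/

/-! ### Comparison with quadratic barriers -/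

/-- A locally minimal affine minorant of a convex function supports it globally. -/
theorem mem_subdifferentialOn_of_isLocalMin {n : ℕ} {Ω : Set (EuclideanSpace ℝ (Fin n))}
    {u : EuclideanSpace ℝ (Fin n) → ℝ} (hu : ConvexOn ℝ Ω u)
    {x p : EuclideanSpace ℝ (Fin n)} (hx : x ∈ Ω)
    (h : IsLocalMin (fun y => u y - inner ℝ p y) x) : p ∈ subdifferentialOn Ω u x := by
  have hlin : ConcaveOn ℝ Ω (fun y : EuclideanSpace ℝ (Fin n) => inner ℝ p y) :=
    ((innerSL ℝ p).toLinearMap.concaveOn hu.1)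
  have := IsMinOn.of_isLocalMinOn_of_convexOn hx (h.on Ω) (hu.sub hlin)
  intro y hy
  have := this hy
  simp only [Set.mem_ofPred_eq] at this
  rw [inner_sub_right]
  linarith

theorem volume_image_affine_diagonal {n : ℕ} (p : EuclideanSpace ℝ (Fin n)) (c : Fin n → ℝ)
    (E : Set (EuclideanSpace ℝ (Fin n))) :
    volume ((fun x : EuclideanSpace ℝ (Fin n) => p + WithLp.toLp 2 (fun i => c i * x i)) '' E)
      = ENNReal.ofReal |∏ i, c i| * volume E := by
  have h1 : (fun x : EuclideanSpace ℝ (Fin n) => p + WithLp.toLp 2 (fun i => c i * x i)) '' E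
      = (fun y => p + y) '' (Matrix.toEuclideanLin (Matrix.diagonal c) '' E) := by
    rw [Set.image_image]
    refine Set.image_congr fun x _ => ?_
    congr 1
    ext i
    simp [Matrix.toEuclideanLin, Matrix.mulVec_diagonal]
  rw [h1, Set.image_add_left, measure_preimage_add, Measure.addHaar_image_linearMap,
    Matrix.toEuclideanLin, Matrix.toLpLin_eq_toLin, LinearMap.det_toLin, Matrix.det_diagonal]

/-- Comparison with quadratic barriers on the set `{u < L}`. Where the barrier `b` exceeds `u`,
every gradient of `b` is a slope of `u`, so that the set `{u < L, u < b}` would carry more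
Monge–Ampère mass of `u` than allowed. -/
theorem quadratic_le_of_volume_subdifferential_le {n : ℕ} {Ω : Set (EuclideanSpace ℝ (Fin n))}
    (hΩ : IsOpen Ω) (hΩc : Convex ℝ Ω) (hbd : Bornology.IsBounded Ω)
    {u L : EuclideanSpace ℝ (Fin n) → ℝ} {Λ : ℝ}
    (hconv : ConvexOn ℝ (closure Ω) u) (hcont : ContinuousOn u (closure Ω))
    (hvol : ∀ E : Set (EuclideanSpace ℝ (Fin n)), MeasurableSet E → E ⊆ Ω →
      volume (⋃ x ∈ E, subdifferentialOn Ω u x) ≤ ENNReal.ofReal Λ * volume E)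
    (hL : Continuous L) {p : EuclideanSpace ℝ (Fin n)} {k : ℝ} {c : Fin n → ℝ}
    (hc : ∀ i, 0 < c i) (hdet : Λ < ∏ i, (2 * c i)) {b : EuclideanSpace ℝ (Fin n) → ℝ}
    (hb : ∀ x, b x = inner ℝ p x + k + ∑ i, c i * x i ^ 2)
    (hbL : ∀ x ∈ closure Ω, u x ≤ L x → b x ≤ L x)
    (hbu : ∀ x ∈ closure Ω, x ∉ Ω → u x ≤ L x → b x ≤ u x) :
    ∀ x ∈ closure Ω, u x < L x → b x ≤ u x := by
  intro x₀ hx₀ hx₀L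
  by_contra! hlt
  have hx₀Ω : x₀ ∈ Ω := by
    by_contra hn
    exact absurd (hbu x₀ hx₀ hn hx₀L.le) (not_le.2 hlt)
  have hbc : Continuous b := by
    rw [show b = _ from funext hb]
    fun_prop
  have hcontΩ : ContinuousOn u Ω := hcont.mono subset_closure
  set E : Set (EuclideanSpace ℝ (Fin n)) := {x | x ∈ Ω ∧ u x < L x ∧ u x < b x} with hE
  have hEo : IsOpen E := by
    have h1 := (hcontΩ.sub hL.continuousOn).isOpen_inter_preimage hΩ (isOpen_Iio (a := (0 : ℝ)))
    have h2 := (hcontΩ.sub hbc.continuousOn).isOpen_inter_preimage hΩ (isOpen_Iio (a := (0 : ℝ)))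
    convert h1.inter h2 using 1
    ext x
    simp only [hE, Set.mem_inter_iff, Set.mem_preimage, Set.mem_Iio, Pi.sub_apply, sub_neg]
    exact ⟨fun h => ⟨⟨h.1, h.2.1⟩, h.1, h.2.2⟩, fun h => ⟨h.1.1, h.1.2, h.2.2⟩⟩
  have hEΩ : E ⊆ Ω := fun x hx => hx.1
  set g : EuclideanSpace ℝ (Fin n) → EuclideanSpace ℝ (Fin n) :=
    fun x => p + WithLp.toLp 2 (fun i => (2 * c i) * x i) with hg
  have htan : ∀ x y, b x + inner ℝ (g x) (y - x) ≤ b y := by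
    intro x y
    have h1 : inner ℝ (g x) (y - x)
        = inner ℝ p (y - x) + ∑ i, (2 * c i) * x i * (y i - x i) := by
      rw [hg, inner_add_left]
      congr 1
      simp [PiLp.inner_apply, mul_comm]
    rw [h1, hb, hb, inner_sub_right]
    have h2 : ∑ i, c i * x i ^ 2 + ∑ i, (2 * c i) * x i * (y i - x i) ≤ ∑ i, c i * y i ^ 2 := by
      rw [← Finset.sum_add_distrib]
      refine Finset.sum_le_sum fun i _ => ?_
      nlinarith [mul_nonneg (hc i).le (sq_nonneg (y i - x i))]
    linarith
  have hsub : g '' E ⊆ ⋃ x ∈ E, subdifferentialOn Ω u x := by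
    rintro _ ⟨x, hx, rfl⟩
    have hK : IsCompact (closure Ω ∩ {y | u y ≤ L y}) := by
      have hcl : IsClosed (closure Ω ∩ {y | u y ≤ L y}) := by
        have := (hcont.sub hL.continuousOn).preimage_isClosed_of_isClosed isClosed_closure
          (isClosed_Iic (a := (0 : ℝ)))
        convert this using 1
        ext y
        simp
      exact hbd.isCompact_closure.of_isClosed_subset hcl Set.inter_subset_left
    obtain ⟨z, hz, hzmin⟩ := hK.exists_isMinOn (f := fun y => u y - inner ℝ (g x) y)
      ⟨x, subset_closure hx.1, hx.2.1.le⟩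
      ((hcont.mono Set.inter_subset_left).sub (by fun_prop))
    have hzx : u z - inner ℝ (g x) z ≤ u x - inner ℝ (g x) x :=
      hzmin ⟨subset_closure hx.1, hx.2.1.le⟩
    have hzb : u z < b z := by
      have := htan x z
      rw [inner_sub_right] at this
      linarith [hx.2.2]
    have hzΩ : z ∈ Ω := by
      by_contra hn
      exact absurd (hbu z hz.1 hn hz.2) (not_le.2 hzb)
    have hzE : z ∈ E := ⟨hzΩ, hzb.trans_le (hbL z hz.1 hz.2), hzb⟩
    refine Set.mem_biUnion hzE ?_
    refine mem_subdifferentialOn_of_isLocalMin (hconv.subset subset_closure hΩc) hzΩ ?_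
    filter_upwards [hEo.mem_nhds hzE] with y hy
    exact hzmin ⟨subset_closure hy.1, hy.2.1.le⟩
  have hdet0 : 0 < ∏ i, (2 * c i) := Finset.prod_pos fun i _ => by have := hc i; positivity
  have hle : ENNReal.ofReal (∏ i, (2 * c i)) * volume E ≤ ENNReal.ofReal Λ * volume E := by
    calc _ = volume (g '' E) := by rw [hg, volume_image_affine_diagonal, abs_of_pos hdet0]
      _ ≤ _ := measure_mono hsub
      _ ≤ _ := hvol E hEo.measurableSet hEΩ
  have hE0 : volume E ≠ 0 := (hEo.measure_pos volume ⟨x₀, hx₀Ω, hx₀L, hlt⟩).ne'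
  have hEt : volume E ≠ ⊤ := (hbd.subset hEΩ).measure_lt_top.ne
  rw [ENNReal.mul_le_mul_iff_left hE0 hEt] at hle
  exact absurd hle (not_le.2 ((ENNReal.ofReal_lt_ofReal_iff hdet0).2 hdet))

/-! ### Coordinates of the half ball -/

theorem horizontalPart_add {m : ℕ} (x y : EuclideanSpace ℝ (Fin (m + 1))) :
    horizontalPart (x + y) = horizontalPart x + horizontalPart y := by
  ext i; simp [horizontalPart]

theorem horizontalPart_smul {m : ℕ} (t : ℝ) (x : EuclideanSpace ℝ (Fin (m + 1))) :
    horizontalPart (t • x) = t • horizontalPart x := by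
  ext i; simp [horizontalPart]

theorem continuous_horizontalPart {m : ℕ} :
    Continuous (horizontalPart : EuclideanSpace ℝ (Fin (m + 1)) → _) := by
  unfold horizontalPart
  fun_prop

theorem norm_sq_eq_horizontalPart {m : ℕ} (x : EuclideanSpace ℝ (Fin (m + 1))) :
    ‖x‖ ^ 2 = ‖horizontalPart x‖ ^ 2 + x (Fin.last m) ^ 2 := by
  simp [EuclideanSpace.real_norm_sq_eq, Fin.sum_univ_castSucc, horizontalPart]

theorem norm_horizontalPart_le {m : ℕ} (x : EuclideanSpace ℝ (Fin (m + 1))) :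
    ‖horizontalPart x‖ ≤ ‖x‖ := by
  have := norm_sq_eq_horizontalPart x
  exact le_of_sq_le_sq (by nlinarith [sq_nonneg (x (Fin.last m))]) (norm_nonneg _)

theorem apply_last_le_norm {m : ℕ} (x : EuclideanSpace ℝ (Fin (m + 1))) :
    x (Fin.last m) ≤ ‖x‖ :=
  (le_abs_self _).trans (PiLp.norm_apply_le x _)

/-- The vector `(w, t)` with horizontal part `w` and last coordinate `t`. -/
def ofHorizontal {m : ℕ} (w : EuclideanSpace ℝ (Fin m)) (t : ℝ) :
    EuclideanSpace ℝ (Fin (m + 1)) :=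
  WithLp.toLp 2 (Fin.snoc (α := fun _ => ℝ) w t)

@[simp] theorem horizontalPart_ofHorizontal {m : ℕ} (w : EuclideanSpace ℝ (Fin m)) (t : ℝ) :
    horizontalPart (ofHorizontal w t) = w := by
  ext i; simp [horizontalPart, ofHorizontal]

@[simp] theorem ofHorizontal_last {m : ℕ} (w : EuclideanSpace ℝ (Fin m)) (t : ℝ) :
    ofHorizontal w t (Fin.last m) = t := by
  simp [ofHorizontal]

theorem ext_horizontalPart {m : ℕ} {x y : EuclideanSpace ℝ (Fin (m + 1))}
    (h : horizontalPart x = horizontalPart y) (h' : x (Fin.last m) = y (Fin.last m)) : x = y := by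
  ext i
  refine Fin.lastCases h' (fun j => ?_) i
  have := congrArg (fun v : EuclideanSpace ℝ (Fin m) => v j) h
  simpa [horizontalPart] using this

theorem inner_ofHorizontal {m : ℕ} (w : EuclideanSpace ℝ (Fin m)) (t : ℝ)
    (x : EuclideanSpace ℝ (Fin (m + 1))) :
    inner ℝ (ofHorizontal w t) x = inner ℝ w (horizontalPart x) + t * x (Fin.last m) := by
  simp [PiLp.inner_apply, Fin.sum_univ_castSucc, horizontalPart, ofHorizontal, mul_comm]

theorem isOpen_upperHalfBall (m : ℕ) : IsOpen (upperHalfBall m) := by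
  have h1 : IsOpen {x : EuclideanSpace ℝ (Fin (m + 1)) | ‖x‖ < 1} :=
    isOpen_lt continuous_norm continuous_const
  have h2 : IsOpen {x : EuclideanSpace ℝ (Fin (m + 1)) | 0 < x (Fin.last m)} :=
    isOpen_lt continuous_const (by fun_prop)
  exact h1.inter h2

theorem convex_upperHalfBall (m : ℕ) : Convex ℝ (upperHalfBall m) := by
  intro x hx y hy a b ha hb hab
  refine ⟨?_, ?_⟩
  · have h := convex_ball (0 : EuclideanSpace ℝ (Fin (m + 1))) 1
      (mem_ball_zero_iff.2 hx.1) (mem_ball_zero_iff.2 hy.1) ha hb hab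
    exact mem_ball_zero_iff.1 h
  · have h := convex_Ioi (0 : ℝ) (Set.mem_Ioi.2 hx.2) (Set.mem_Ioi.2 hy.2) ha hb hab
    simpa using h

theorem isBounded_upperHalfBall (m : ℕ) : Bornology.IsBounded (upperHalfBall m) :=
  (Metric.isBounded_ball (x := 0) (r := 1)).subset fun _ hx => mem_ball_zero_iff.2 hx.1

theorem norm_le_one_of_mem_closure {m : ℕ} {x : EuclideanSpace ℝ (Fin (m + 1))}
    (hx : x ∈ closure (upperHalfBall m)) : ‖x‖ ≤ 1 :=
  closure_minimal (t := {x : EuclideanSpace ℝ (Fin (m + 1)) | ‖x‖ ≤ 1})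
    (fun _ hy => hy.1.le) (isClosed_le continuous_norm continuous_const) hx

theorem last_nonneg_of_mem_closure {m : ℕ} {x : EuclideanSpace ℝ (Fin (m + 1))}
    (hx : x ∈ closure (upperHalfBall m)) : 0 ≤ x (Fin.last m) :=
  closure_minimal (t := {x : EuclideanSpace ℝ (Fin (m + 1)) | 0 ≤ x (Fin.last m)})
    (fun _ hy => hy.2.le) (isClosed_le continuous_const (by fun_prop)) hx

theorem last_eq_zero_or_norm_eq_one {m : ℕ} {x : EuclideanSpace ℝ (Fin (m + 1))}
    (hx : x ∈ closure (upperHalfBall m)) (hn : x ∉ upperHalfBall m) :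
    x (Fin.last m) = 0 ∨ ‖x‖ = 1 := by
  by_contra! h
  exact hn ⟨lt_of_le_of_ne (norm_le_one_of_mem_closure hx) h.2,
    lt_of_le_of_ne (last_nonneg_of_mem_closure hx) h.1.symm⟩

theorem mem_frontier_upperHalfBall {m : ℕ} {x : EuclideanSpace ℝ (Fin (m + 1))}
    (hx : x ∈ closure (upperHalfBall m)) (hn : x ∉ upperHalfBall m) :
    x ∈ frontier (upperHalfBall m) :=
  ⟨hx, by rwa [(isOpen_upperHalfBall m).interior_eq]⟩

theorem ofHorizontal_zero_mem_closure {m : ℕ} {w : EuclideanSpace ℝ (Fin m)} (hw : ‖w‖ < 1) :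
    ofHorizontal w 0 ∈ closure (upperHalfBall m) := by
  set x : EuclideanSpace ℝ (Fin (m + 1)) := ofHorizontal w 0
  have hlim : Filter.Tendsto (fun t : ℝ => x + t • ofHorizontal 0 1)
      (nhdsWithin 0 (Set.Ioi 0)) (nhds x) := by
    have : Continuous (fun t : ℝ => x + t • (ofHorizontal 0 1 : EuclideanSpace ℝ (Fin (m + 1)))) := by
      fun_prop
    simpa using (this.tendsto 0).mono_left nhdsWithin_le_nhds
  refine mem_closure_of_tendsto hlim ?_
  have hx1 : ‖x‖ < 1 := by
    have := norm_sq_eq_horizontalPart x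
    simp only [x, horizontalPart_ofHorizontal, ofHorizontal_last] at this
    exact lt_of_pow_lt_pow_left₀ 2 zero_le_one (by nlinarith [norm_nonneg w])
  filter_upwards [hlim.norm.eventually_lt_const hx1, self_mem_nhdsWithin] with t ht ht0
  refine ⟨ht, ?_⟩
  simpa [x] using ht0

theorem zero_mem_closure_upperHalfBall (m : ℕ) :
    (0 : EuclideanSpace ℝ (Fin (m + 1))) ∈ closure (upperHalfBall m) := by
  have h := ofHorizontal_zero_mem_closure (m := m) (w := 0) (by simp)
  rwa [ext_horizontalPart (x := ofHorizontal (0 : EuclideanSpace ℝ (Fin m)) 0) (y := 0)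
    (by ext; simp [horizontalPart, ofHorizontal]) (by simp)] at h

/-! ### Solutions that separate quadratically from zero on the boundary -/

/-- The lower hypotheses on the solution: `u ≥ 0` is convex with `u(0) = 0` and
`det D²u ≤ Λ`, and on the boundary part `{xₙ ≤ ρ}` it separates quadratically from zero. -/
structure IsSeparatedSupersolution (m : ℕ) (Λ μ ρ : ℝ)
    (u : EuclideanSpace ℝ (Fin (m + 1)) → ℝ) : Prop where
  convexOn : ConvexOn ℝ (closure (upperHalfBall m)) u
  continuousOn : ContinuousOn u (closure (upperHalfBall m))
  volume_le : ∀ E : Set (EuclideanSpace ℝ (Fin (m + 1))), MeasurableSet E → E ⊆ upperHalfBall m →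
    volume (⋃ x ∈ E, subdifferentialOn (upperHalfBall m) u x) ≤ ENNReal.ofReal Λ * volume E
  nonneg : ∀ x ∈ closure (upperHalfBall m), 0 ≤ u x
  zero : u 0 = 0
  le_of_notMem : ∀ x ∈ closure (upperHalfBall m), x ∉ upperHalfBall m → x (Fin.last m) ≤ ρ →
    μ * ‖x‖ ^ 2 ≤ u x

namespace IsSeparatedSupersolution

variable {m : ℕ} {Λ μ ρ : ℝ} {u : EuclideanSpace ℝ (Fin (m + 1)) → ℝ}

/-- Comparison with a barrier `q · x' + e xₙ + k + a |x'|² + M xₙ²` on `{u < L}`. -/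
theorem barrier_le (hu : IsSeparatedSupersolution m Λ μ ρ u)
    {L : EuclideanSpace ℝ (Fin (m + 1)) → ℝ} (hL : Continuous L)
    (q : EuclideanSpace ℝ (Fin m)) (e k : ℝ) {a M : ℝ} (ha : 0 < a) (hM : 0 < M)
    (hdet : Λ < (2 * a) ^ m * (2 * M)) {b : EuclideanSpace ℝ (Fin (m + 1)) → ℝ}
    (hb : ∀ x, b x = inner ℝ q (horizontalPart x) + e * x (Fin.last m) + k +
      (a * ‖horizontalPart x‖ ^ 2 + M * x (Fin.last m) ^ 2))
    (hbL : ∀ x ∈ closure (upperHalfBall m), u x ≤ L x → b x ≤ L x)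
    (hbu : ∀ x ∈ closure (upperHalfBall m), x ∉ upperHalfBall m → u x ≤ L x → b x ≤ u x) :
    ∀ x ∈ closure (upperHalfBall m), u x < L x → b x ≤ u x := by
  refine quadratic_le_of_volume_subdifferential_le (isOpen_upperHalfBall m)
    (convex_upperHalfBall m) (isBounded_upperHalfBall m) hu.convexOn hu.continuousOn hu.volume_le
    hL (p := ofHorizontal q e) (k := k)
    (c := fun i => Fin.lastCases (motive := fun _ => ℝ) M (fun _ => a) i) ?_ ?_ ?_ hbL hbu
  · intro i
    refine Fin.lastCases ?_ (fun j => ?_) i <;> simpa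
  · simpa [Fin.prod_univ_castSucc] using hdet
  · intro x
    rw [hb, inner_ofHorizontal, Fin.sum_univ_castSucc, EuclideanSpace.real_norm_sq_eq,
      Finset.mul_sum]
    simp [horizontalPart]

/-- A single quadratic barrier on the whole half ball propagates the quadratic separation on the
flat boundary to the interior, up to an error linear in the height. -/
theorem exists_quadratic_sub_linear_le (m : ℕ) {Λ μ ρ : ℝ} (hΛ : 0 < Λ) (hμ : 0 < μ)
    (hρ : 0 < ρ) : ∃ K : ℝ, 1 ≤ K ∧ ∀ u : EuclideanSpace ℝ (Fin (m + 1)) → ℝ,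
      IsSeparatedSupersolution m Λ μ ρ u → ∀ x ∈ closure (upperHalfBall m),
        μ * ‖horizontalPart x‖ ^ 2 - K * x (Fin.last m) ≤ u x := by
  set M : ℝ := Λ / (2 * μ) ^ m with hMdef
  have hM : 0 < M := by positivity
  refine ⟨max 1 (max M ((μ + M) / ρ)), le_max_left _ _, fun u hu x hx => ?_⟩
  set K : ℝ := max 1 (max M ((μ + M) / ρ))
  have hKM : M ≤ K := (le_max_left _ _).trans (le_max_right _ _)
  have hKρ : μ + M ≤ K * ρ := by
    rw [← div_le_iff₀ hρ]
    exact (le_max_right _ _).trans (le_max_right _ _)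
  set b : EuclideanSpace ℝ (Fin (m + 1)) → ℝ := fun x =>
    inner ℝ (0 : EuclideanSpace ℝ (Fin m)) (horizontalPart x) + (-K) * x (Fin.last m) + 0 +
      (μ * ‖horizontalPart x‖ ^ 2 + M * x (Fin.last m) ^ 2) with hb
  have hbc : Continuous b := by
    have := continuous_horizontalPart (m := m)
    fun_prop
  have hbu : b x ≤ u x := by
    by_contra! hlt
    refine absurd (hu.barrier_le (L := fun x => b x + 1) (by fun_prop) 0 (-K) 0 hμ hM ?_
      (b := b) (fun _ => rfl) (fun y _ _ => by linarith) ?_ x hx (by linarith)) (not_le.2 hlt)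
    · rw [hMdef]
      have : (2 * μ) ^ m * (2 * (Λ / (2 * μ) ^ m)) = 2 * Λ := by field_simp
      linarith
    · intro y hy hn _
      have h0 := last_nonneg_of_mem_closure hy
      have h1 := norm_le_one_of_mem_closure hy
      have h2 := norm_sq_eq_horizontalPart y
      have h3 := apply_last_le_norm y
      have h4 : ‖y‖ ^ 2 ≤ 1 := by nlinarith [norm_nonneg y]
      simp only [hb, inner_zero_left]
      rcases le_total (y (Fin.last m)) ρ with h | h
      · have := hu.le_of_notMem y hy hn h
        nlinarith [mul_nonneg h0 (sub_nonneg.2 (h3.trans h1)),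
          mul_nonneg (sub_nonneg.2 hKM) h0, mul_nonneg hμ.le (sq_nonneg (y (Fin.last m)))]
      · have := hu.nonneg y hy
        have h5 : μ * ‖horizontalPart y‖ ^ 2 ≤ μ := by
          nlinarith [sq_nonneg (y (Fin.last m))]
        have h6 : M * y (Fin.last m) ^ 2 ≤ M := by
          nlinarith [sq_nonneg ‖horizontalPart y‖]
        have h7 : K * ρ ≤ K * y (Fin.last m) :=
          mul_le_mul_of_nonneg_left h (hM.le.trans hKM)
        linarith
  simp only [hb, inner_zero_left] at hbu
  nlinarith [mul_nonneg hM.le (sq_nonneg (x (Fin.last m)))]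

end IsSeparatedSupersolution

/-! ### Growth of the solution at a given scale -/

namespace IsSeparatedSupersolution

variable {m : ℕ} {Λ μ ρ : ℝ} {u : EuclideanSpace ℝ (Fin (m + 1)) → ℝ}

/-- If `u(y) > h` at a point `y` close to the origin while `u ≤ h` on a much larger flat disc, then
`u` grows at least linearly in the height, up to a small tilt: otherwise `y` would lie in the
convex hull of the disc and a point of `{u ≤ h}`. -/
theorem last_le_of_lt_apply (hu : IsSeparatedSupersolution m Λ μ ρ u) {h r s : ℝ} (hh : 0 < h)
    (hr : 0 < r) (hr1 : r < 1) (hs : 4 * s ≤ r)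
    (hflat : ∀ w : EuclideanSpace ℝ (Fin m), ‖w‖ ≤ r → u (ofHorizontal w 0) ≤ h)
    {y : EuclideanSpace ℝ (Fin (m + 1))} (hy : ‖y‖ ≤ s) (hy0 : 0 < y (Fin.last m))
    (huy : h < u y) :
    ∀ x ∈ closure (upperHalfBall m),
      x (Fin.last m) ≤ 4 * s / h * max (u x) h + 4 * s / r * ‖horizontalPart x‖ := by
  intro x hx
  by_contra! hlt
  set k := max (u x) h with hk
  have hkh : h ≤ k := le_max_right _ _
  have hk0 : 0 < k := hh.trans_le hkh
  have hys : y (Fin.last m) ≤ s := (apply_last_le_norm y).trans hy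
  have hs0 : 0 < s := hy0.trans_le hys
  set t := h / k with ht
  have ht0 : 0 < t := by positivity
  have ht1 : t ≤ 1 := (div_le_one hk0).2 hkh
  have hzero := zero_mem_closure_upperHalfBall m
  set z := t • x with hz
  have hzmem : z ∈ closure (upperHalfBall m) := by
    have := hu.convexOn.1 hx hzero ht0.le (sub_nonneg.2 ht1) (by ring)
    simpa using this
  have huz : u z ≤ h := by
    have h1 := hu.convexOn.2 hx hzero ht0.le (sub_nonneg.2 ht1) (by ring)
    simp only [smul_zero, add_zero, hu.zero, smul_eq_mul, mul_zero] at h1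
    refine h1.trans ?_
    calc t * u x ≤ t * k := mul_le_mul_of_nonneg_left (le_max_left _ _) ht0.le
      _ = h := by rw [ht]; field_simp
  have hzn : 4 * s * r + 4 * s * ‖horizontalPart z‖ < r * z (Fin.last m) := by
    have h1 : z (Fin.last m) = t * x (Fin.last m) := by simp [hz]
    have h2 : ‖horizontalPart z‖ = t * ‖horizontalPart x‖ := by
      rw [hz, horizontalPart_smul, norm_smul, Real.norm_of_nonneg ht0.le]
    have h3 := mul_lt_mul_of_pos_left hlt (mul_pos hr ht0)
    have h4 : r * t * (4 * s / h * k + 4 * s / r * ‖horizontalPart x‖)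
        = 4 * s * r + 4 * s * (t * ‖horizontalPart x‖) := by
      rw [ht]; field_simp
    rw [h1, h2]
    linarith
  have hz0 : 0 < z (Fin.last m) := by
    have : 0 < r * z (Fin.last m) := lt_of_le_of_lt (by positivity) hzn
    exact pos_of_mul_pos_right this hr.le
  set τ := y (Fin.last m) / z (Fin.last m) with hτ
  have hτ0 : 0 < τ := by positivity
  have hτ4 : τ ≤ 1 / 4 := by
    rw [hτ, div_le_iff₀ hz0]
    have : 4 * s * r < r * z (Fin.last m) :=
      lt_of_le_of_lt (le_add_of_nonneg_right (by positivity)) hzn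
    have : 4 * s < z (Fin.last m) := by nlinarith
    linarith
  have hτz : τ * ‖horizontalPart z‖ ≤ r / 4 := by
    rw [hτ, div_mul_eq_mul_div, div_le_iff₀ hz0]
    have : y (Fin.last m) * ‖horizontalPart z‖ ≤ s * ‖horizontalPart z‖ :=
      mul_le_mul_of_nonneg_right hys (norm_nonneg _)
    nlinarith [mul_pos hs0 hr]
  set w := (1 - τ)⁻¹ • (horizontalPart y - τ • horizontalPart z) with hw
  have h1τ : 0 < 1 - τ := by linarith
  have hwr : ‖w‖ ≤ r := by
    rw [hw, norm_smul, norm_inv, Real.norm_of_nonneg h1τ.le, inv_mul_le_iff₀ h1τ]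
    have h1 := norm_sub_le (horizontalPart y) (τ • horizontalPart z)
    rw [norm_smul, Real.norm_of_nonneg hτ0.le] at h1
    have h2 := (norm_horizontalPart_le y).trans hy
    nlinarith
  have hyeq : τ • z + (1 - τ) • ofHorizontal w 0 = y := by
    refine ext_horizontalPart ?_ ?_
    · rw [horizontalPart_add, horizontalPart_smul, horizontalPart_smul (1 - τ),
        horizontalPart_ofHorizontal, hw, smul_inv_smul₀ h1τ.ne']
      abel
    · simp only [PiLp.add_apply, PiLp.smul_apply, ofHorizontal_last, smul_eq_mul, mul_zero,
        add_zero]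
      rw [hτ]; field_simp
  have hconv := hu.convexOn.2 hzmem (ofHorizontal_zero_mem_closure (hwr.trans_lt hr1)) hτ0.le
    h1τ.le (by ring)
  rw [hyeq, smul_eq_mul, smul_eq_mul] at hconv
  have := hflat w hwr
  nlinarith

set_option maxHeartbeats 400000 in
/-- Quadratic growth in the horizontal directions. At a point `z` of maximal `|z'|` where it fails,
the section of `u` under the affine function `μ z' · x' - μ |z'|² / 4` stays away from the flat
boundary. It is so thin, by the linear growth in the height, that `det D²u ≤ Λ` forces a
depth smaller than the one it has at `z`. -/
theorem quadratic_le_max (hu : IsSeparatedSupersolution m Λ μ ρ u) (hμ : 0 < μ) (hΛ : 0 < Λ)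
    {K h β γ A : ℝ} (hK : 1 ≤ K) (hh : 0 < h) (hβ : 1 ≤ β) (hγ : 0 < γ)
    (hA : A = 2 * (1 + K * β))
    (hlow : ∀ x ∈ closure (upperHalfBall m),
      μ * ‖horizontalPart x‖ ^ 2 - K * x (Fin.last m) ≤ u x)
    (hcone : ∀ x ∈ closure (upperHalfBall m),
      x (Fin.last m) ≤ β * max (u x) h + γ * ‖horizontalPart x‖)
    (hdet : Λ * (A ^ (2 * m + 4) * γ ^ 2) < (μ / 4) ^ (m + 1))
    (hside : A * (2 * K * γ / μ) ^ 2 < 1) (hheight : A * (2 * K * γ / μ) * (γ * A) ≤ ρ) :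
    ∀ x ∈ closure (upperHalfBall m), μ / A * ‖horizontalPart x‖ ^ 2 ≤ max (u x) h := by
  intro x₀ hx₀
  by_contra! hlt₀
  have hKβ : 1 ≤ K * β := one_le_mul_of_one_le_of_one_le hK hβ
  have hA4 : 4 ≤ A := by linarith
  have hA0 : 0 < A := by linarith
  have hcont := hu.continuousOn
  have hhc := continuous_horizontalPart (m := m)
  set κ := μ / A with hκ
  have hκ0 : 0 < κ := by positivity
  have hκA : κ * A = μ := div_mul_cancel₀ _ hA0.ne'
  have hκ4 : 4 * κ ≤ μ := by
    rw [← hκA, mul_comm κ]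
    exact mul_le_mul_of_nonneg_right hA4 hκ0.le
  -- a failing point with maximal horizontal distance
  obtain ⟨z, ⟨hzmem, hzκ⟩, hzmax⟩ : ∃ z ∈ closure (upperHalfBall m) ∩
      {x | max (u x) h - κ * ‖horizontalPart x‖ ^ 2 ≤ 0},
      IsMaxOn (fun x => ‖horizontalPart x‖) (closure (upperHalfBall m) ∩
        {x | max (u x) h - κ * ‖horizontalPart x‖ ^ 2 ≤ 0}) z := by
    have hcl : IsClosed (closure (upperHalfBall m) ∩
        {x | max (u x) h - κ * ‖horizontalPart x‖ ^ 2 ≤ 0}) := by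
      have hc : ContinuousOn (fun x => max (u x) h - κ * ‖horizontalPart x‖ ^ 2)
          (closure (upperHalfBall m)) := by fun_prop
      exact hc.preimage_isClosed_of_isClosed isClosed_closure (isClosed_Iic (a := (0 : ℝ)))
    refine ((isBounded_upperHalfBall m).isCompact_closure.of_isClosed_subset hcl
      Set.inter_subset_left).exists_isMaxOn ⟨x₀, hx₀, ?_⟩ (by fun_prop)
    simpa using hlt₀.le
  have hzκ' : max (u z) h ≤ κ * ‖horizontalPart z‖ ^ 2 := by simpa using hzκ
  set d := ‖horizontalPart z‖ with hd
  have hmax : ∀ x ∈ closure (upperHalfBall m), d < ‖horizontalPart x‖ →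
      κ * ‖horizontalPart x‖ ^ 2 < max (u x) h := by
    intro x hx hdx
    by_contra! hle
    exact absurd (hzmax ⟨hx, by simpa using hle⟩) (not_le.2 hdx)
  have huz : u z ≤ κ * d ^ 2 := (le_max_left _ _).trans hzκ'
  have hhd : h ≤ κ * d ^ 2 := (le_max_right _ _).trans hzκ'
  have hd0 : 0 < d := by
    refine lt_of_le_of_ne (norm_nonneg _) fun h0 => ?_
    rw [← h0] at hhd
    simp at hhd
    linarith
  have hμd : 0 < μ * d ^ 2 := by positivity
  have hκd : κ * d ^ 2 ≤ μ * d ^ 2 / 4 := by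
    have := mul_le_mul_of_nonneg_right hκ4 (sq_nonneg d)
    linarith
  have hdγ : d ≤ 2 * K * γ / μ := by
    rw [le_div_iff₀ hμ]
    have h1 := hlow z hzmem
    have h2 := hcone z hzmem
    rw [← hd] at h1 h2
    have h3 : K * z (Fin.last m) ≤ K * (β * (κ * d ^ 2) + γ * d) :=
      mul_le_mul_of_nonneg_left (h2.trans (by gcongr)) (by linarith)
    have h4 : μ * d ^ 2 ≤ κ * (1 + K * β) * d ^ 2 + K * γ * d := by linarith
    have h5 : κ * (1 + K * β) = μ / 2 := by rw [← hκA, hA]; ring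
    rw [h5] at h4
    have : d * (d * μ) ≤ d * (2 * K * γ) := by linarith
    exact le_of_mul_le_mul_left this hd0
  set L : EuclideanSpace ℝ (Fin (m + 1)) → ℝ :=
    fun x => μ * inner ℝ (horizontalPart z) (horizontalPart x) - μ * d ^ 2 / 4 with hL
  have hLc : Continuous L := by fun_prop
  have hLle : ∀ x, L x ≤ μ * d * ‖horizontalPart x‖ := by
    intro x
    have h1 := real_inner_le_norm (horizontalPart z) (horizontalPart x)
    have h2 := mul_le_mul_of_nonneg_left h1 hμ.le
    rw [← hd] at h2
    have : 0 ≤ μ * d ^ 2 / 4 := by positivity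
    simp only [hL]
    linarith
  -- the section `{u ≤ L}` is contained in a thin box
  have hbox1 : ∀ x ∈ closure (upperHalfBall m), u x ≤ L x → ‖horizontalPart x‖ ≤ A * d := by
    intro x hx hux
    rcases le_or_gt ‖horizontalPart x‖ d with hle | hgt
    · exact hle.trans (le_mul_of_one_le_left hd0.le (by linarith))
    · have h1 := hmax x hx hgt
      have h2 : h < κ * ‖horizontalPart x‖ ^ 2 :=
        lt_of_le_of_lt hhd (by gcongr)
      have h3 : κ * ‖horizontalPart x‖ ^ 2 < u x := by
        rcases lt_max_iff.1 h1 with h | h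
        · exact h
        · linarith
      have h4 := h3.trans_le (hux.trans (hLle x))
      have h5 : 0 < ‖horizontalPart x‖ := hd0.trans hgt
      have h6 : (κ * ‖horizontalPart x‖) * ‖horizontalPart x‖
          < (κ * (A * d)) * ‖horizontalPart x‖ := by
        rw [← mul_assoc κ A d, hκA]; linarith
      exact (lt_of_mul_lt_mul_left (lt_of_mul_lt_mul_right h6 h5.le) hκ0.le).le
  set T := A * d * (β * μ * d + γ) with hT
  have hT0 : 0 < T := by positivity
  have hbox2 : ∀ x ∈ closure (upperHalfBall m), u x ≤ L x → x (Fin.last m) ≤ T := by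
    intro x hx hux
    have h1 := hbox1 x hx hux
    have h2 : max (u x) h ≤ μ * d * (A * d) := by
      refine max_le (hux.trans ((hLle x).trans (by gcongr))) (hhd.trans ?_)
      have : μ * d ^ 2 ≤ μ * d ^ 2 * A := le_mul_of_one_le_right hμd.le (by linarith)
      linarith
    calc x (Fin.last m) ≤ β * max (u x) h + γ * ‖horizontalPart x‖ := hcone x hx
      _ ≤ β * (μ * d * (A * d)) + γ * (A * d) := by gcongr
      _ = T := by rw [hT]; ring
  have hsum : β * μ * d + γ ≤ γ * A := by
    have h1 : d * μ ≤ 2 * K * γ := (le_div_iff₀ hμ).1 hdγ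
    have h2 : β * (d * μ) ≤ β * (2 * K * γ) := mul_le_mul_of_nonneg_left h1 (by linarith)
    rw [hA]
    linarith
  have hTρ : T ≤ ρ := by
    refine le_trans ?_ hheight
    rw [hT]
    gcongr
  have hAd : A * d ^ 2 < 1 := lt_of_le_of_lt (by gcongr) hside
  have hbdry : ∀ x ∈ closure (upperHalfBall m), x ∉ upperHalfBall m → u x ≤ L x → L x ≤ u x := by
    intro x hx hn hux
    have h1 := hu.le_of_notMem x hx hn ((hbox2 x hx hux).trans hTρ)
    rcases last_eq_zero_or_norm_eq_one hx hn with h0 | h0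
    · refine le_trans ?_ h1
      have h2 := real_inner_le_norm (horizontalPart z) (horizontalPart x)
      rw [← hd] at h2
      have h3 := mul_le_mul_of_nonneg_left h2 hμ.le
      rw [norm_sq_eq_horizontalPart, h0]
      have h4 := mul_nonneg hμ.le (sq_nonneg (d / 2 - ‖horizontalPart x‖))
      simp only [hL]
      linarith
    · rw [h0] at h1
      have h2 := (hLle x).trans (mul_le_mul_of_nonneg_left (hbox1 x hx hux) (by positivity))
      have h3 : μ * (A * d ^ 2) < μ * 1 := mul_lt_mul_of_pos_left hAd hμ
      linarith
  set η := μ * d ^ 2 / 8 with hη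
  have hη0 : 0 < η := by positivity
  have hzz : L z = 3 / 4 * (μ * d ^ 2) := by
    simp only [hL, real_inner_self_eq_norm_sq, ← hd]
    ring
  have hzlt : u z < L z := by
    rw [hzz]
    linarith
  set b : EuclideanSpace ℝ (Fin (m + 1)) → ℝ := fun x => L x +
    η * (‖horizontalPart x‖ ^ 2 / (A * d) ^ 2 + x (Fin.last m) ^ 2 / T ^ 2 - 2) with hb
  have hbL : ∀ x ∈ closure (upperHalfBall m), u x ≤ L x → b x ≤ L x := by
    intro x hx hux
    have h1 : ‖horizontalPart x‖ ^ 2 / (A * d) ^ 2 ≤ 1 :=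
      div_le_one_of_le₀ (pow_le_pow_left₀ (norm_nonneg _) (hbox1 x hx hux) 2) (by positivity)
    have h2 : x (Fin.last m) ^ 2 / T ^ 2 ≤ 1 :=
      div_le_one_of_le₀ (pow_le_pow_left₀ (last_nonneg_of_mem_closure hx) (hbox2 x hx hux) 2)
        (by positivity)
    have h3 := mul_nonneg hη0.le (sub_nonneg.2 (add_le_add h1 h2))
    simp only [hb]
    linarith
  have hkey := hu.barrier_le (L := L) hLc (μ • horizontalPart z) 0 (-(μ * d ^ 2 / 4) - 2 * η)
    (a := η / (A * d) ^ 2) (M := η / T ^ 2) (by positivity) (by positivity) ?_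
    (b := b) ?_ ?_ ?_ z hzmem hzlt
  · have h1 : 0 < η * (‖horizontalPart z‖ ^ 2 / (A * d) ^ 2) := by positivity
    have h2 : 0 ≤ η * (z (Fin.last m) ^ 2 / T ^ 2) := by positivity
    simp only [hb, hzz] at hkey
    linarith
  · -- the powers of `d` cancel in the determinant
    have h1 : (2 * (η / (A * d) ^ 2)) ^ m * (2 * (η / T ^ 2))
        = (μ / 4) ^ (m + 1) / (A ^ (2 * m + 2) * (β * μ * d + γ) ^ 2) := by
      have e1 : 2 * (η / (A * d) ^ 2) = (μ / 4) / A ^ 2 := by rw [hη]; field_simp; ring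
      have e2 : 2 * (η / T ^ 2) = (μ / 4) / (A ^ 2 * (β * μ * d + γ) ^ 2) := by
        rw [hη, hT]; field_simp; ring
      rw [e1, e2, div_pow, ← pow_mul, div_mul_div_comm]
      congr 1
      ring
    have hβ0 : 0 < β := by linarith
    rw [h1, lt_div_iff₀ (by positivity)]
    refine lt_of_le_of_lt ?_ hdet
    have h2 : (β * μ * d + γ) ^ 2 ≤ (γ * A) ^ 2 := by gcongr
    calc Λ * (A ^ (2 * m + 2) * (β * μ * d + γ) ^ 2)
        ≤ Λ * (A ^ (2 * m + 2) * (γ * A) ^ 2) := by gcongr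
      _ = _ := by ring
  · intro x
    simp only [hb, hL, inner_smul_left, RCLike.conj_to_real]
    ring
  · exact hbL
  · exact fun x hx hn hux => (hbL x hx hux).trans (hbdry x hx hn hux)

/-- If the section `{u ≤ h}` lies in a box that is too small for `det D²u ≤ Λ`, then `u` grows
linearly in the height, that is, its normal derivative at the origin is positive. -/
theorem exists_linear_le (hu : IsSeparatedSupersolution m Λ μ ρ u) (hμ : 0 < μ)
    {h κ T : ℝ} (hh : 0 < h) (hκ : 0 < κ) (hκμ : κ ≤ μ) (hT : 0 < T) (hTρ : T ≤ ρ) (hhμ : h < μ)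
    (hbox1 : ∀ x ∈ closure (upperHalfBall m), u x ≤ h → κ * ‖horizontalPart x‖ ^ 2 ≤ h)
    (hbox2 : ∀ x ∈ closure (upperHalfBall m), u x ≤ h → x (Fin.last m) ≤ T)
    (hdet : Λ * 2 ^ (m + 1) * T ^ 2 < h * κ ^ m) :
    ∃ ε : ℝ, 0 < ε ∧ ∀ x ∈ closure (upperHalfBall m), ε * x (Fin.last m) ≤ u x := by
  have hε : 0 < h / (2 * (1 + T)) := by positivity
  refine ⟨h / (2 * (1 + T)), hε, fun x hx => ?_⟩
  set ε := h / (2 * (1 + T)) with hεdef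
  have hεT : ε * (1 + T) = h / 2 := by rw [hεdef]; field_simp
  rcases le_or_gt h (u x) with hux | hux
  · have h1 := (apply_last_le_norm x).trans (norm_le_one_of_mem_closure hx)
    nlinarith
  have hkey := hu.barrier_le (L := fun _ => h) continuous_const 0 ε 0
    (a := κ / 4) (M := h / (4 * T ^ 2)) (by positivity) (by positivity) ?_
    (b := fun x => inner ℝ 0 (horizontalPart x) + ε * x (Fin.last m) + 0 +
      (κ / 4 * ‖horizontalPart x‖ ^ 2 + h / (4 * T ^ 2) * x (Fin.last m) ^ 2)) (fun _ => rfl)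
    ?_ ?_ x hx hux
  · simp only [inner_zero_left] at hkey
    have : 0 ≤ κ / 4 * ‖horizontalPart x‖ ^ 2 + h / (4 * T ^ 2) * x (Fin.last m) ^ 2 := by
      positivity
    linarith
  · have h1 : (2 * (κ / 4)) ^ m * (2 * (h / (4 * T ^ 2))) = h * κ ^ m / (2 ^ (m + 1) * T ^ 2) := by
      have : 2 * (κ / 4) = κ / 2 := by ring
      rw [this, div_pow]
      field_simp
      ring
    rw [h1, lt_div_iff₀ (by positivity)]
    linarith
  · intro y hy huy
    have h0 := last_nonneg_of_mem_closure hy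
    have h1 := hbox1 y hy huy
    have h2 := hbox2 y hy huy
    have h3 : h / (4 * T ^ 2) * y (Fin.last m) ^ 2 ≤ h / 4 := by
      rw [div_mul_eq_mul_div, div_le_iff₀ (by positivity)]
      have : y (Fin.last m) ^ 2 ≤ T ^ 2 := by gcongr
      nlinarith
    simp only [inner_zero_left]
    nlinarith
  · intro y hy hn huy
    have h1 := hu.le_of_notMem y hy hn ((hbox2 y hy huy).trans hTρ)
    rcases last_eq_zero_or_norm_eq_one hy hn with h0 | h0
    · rw [norm_sq_eq_horizontalPart, h0] at h1
      simp only [inner_zero_left, h0]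
      nlinarith [sq_nonneg ‖horizontalPart y‖]
    · rw [h0] at h1
      linarith

end IsSeparatedSupersolution

/-- The growth estimates combined at one scale `s`: `u ≤ h` in the ball of radius `s` if
`u ≤ h` on the flat disc of radius `r`, provided that `s / r` is small compared to powers of
`s / h`. -/
theorem IsSeparatedSupersolution.apply_le_of_flat_le {m : ℕ} {Λ μ ρ : ℝ}
    {u : EuclideanSpace ℝ (Fin (m + 1)) → ℝ} (hu : IsSeparatedSupersolution m Λ μ ρ u)
    (hμ : 0 < μ) (hρ : 0 < ρ) (hΛ : 0 < Λ)
    (hgrad : ∀ ε : ℝ, 0 < ε → ∃ x ∈ closure (upperHalfBall m), u x < ε * x (Fin.last m))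
    {K h r s A X D : ℝ} (hK : 1 ≤ K) (hh : 0 < h) (hr : 0 < r) (hs : 0 < s)
    (hlow : ∀ x ∈ closure (upperHalfBall m),
      μ * ‖horizontalPart x‖ ^ 2 - K * x (Fin.last m) ≤ u x)
    (hflat : ∀ w : EuclideanSpace ℝ (Fin m), ‖w‖ ≤ r → u (ofHorizontal w 0) ≤ h)
    (hA : A = 2 * (1 + K * (4 * s / h)))
    (hX : X = (4 * s / r) ^ 2 * A ^ (2 * m + 4))
    (hD : D = 32 * (s ^ 2 / h * A ^ m) + 2 / μ * X)
    (hr1 : r < 1) (hh1 : h < 1) (hhμ : h < μ) (hhs : h ≤ s)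
    (hX1 : X < 1) (hX2 : Λ * X < (μ / 4) ^ (m + 1)) (hX3 : (2 * K / μ) ^ 2 * X < 1)
    (hX4 : 2 * K / μ * X < ρ) (hD1 : Λ * 2 ^ (m + 1) * D < μ ^ m) (hD2 : D < ρ ^ 2)
    {y : EuclideanSpace ℝ (Fin (m + 1))} (hy : y ∈ upperHalfBall m) (hys : ‖y‖ ≤ s) :
    u y ≤ h := by
  by_contra! huy
  set β := 4 * s / h with hβ
  set γ := 4 * s / r with hγ
  have hβ1 : 1 ≤ β := by rw [hβ, one_le_div hh]; linarith
  have hγ0 : 0 < γ := by positivity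
  have hKβ : 1 ≤ K * β := one_le_mul_of_one_le_of_one_le hK hβ1
  have hA1 : 1 ≤ A := by linarith
  have hA0 : 0 < A := by linarith
  -- every lower power of `A` is dominated
  have hpow : ∀ k ≤ 2 * m + 4, γ ^ 2 * A ^ k ≤ X := fun k hk => by
    rw [hX]
    gcongr
  have hX0 : 0 < X := by rw [hX]; positivity
  have hγ1 : γ ≤ 1 := by
    have := hpow 0 (by omega)
    nlinarith
  have h4s : 4 * s ≤ r := (div_le_one hr).1 hγ1
  have hcone := hu.last_le_of_lt_apply hh hr hr1 h4s hflat hys hy.2 huy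
  have hquad := hu.quadratic_le_max hμ hΛ hK hh hβ1 hγ0 hA hlow hcone
    (by
      refine lt_of_le_of_lt ?_ hX2
      rw [hX]
      exact le_of_eq (by ring))
    (by
      refine lt_of_le_of_lt ?_ hX3
      calc A * (2 * K * γ / μ) ^ 2 = (2 * K / μ) ^ 2 * (γ ^ 2 * A ^ 1) := by ring
        _ ≤ _ := by gcongr; exact hpow 1 (by omega))
    (by
      refine le_trans ?_ hX4.le
      calc A * (2 * K * γ / μ) * (γ * A) = 2 * K / μ * (γ ^ 2 * A ^ 2) := by ring
        _ ≤ _ := by gcongr; exact hpow 2 (by omega))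
  set κ := μ / A with hκ
  have hκ0 : 0 < κ := by positivity
  set T := β * h + γ * √(h / κ) with hT
  have hT0 : 0 < T := by positivity
  have hTsq : T ^ 2 * A ^ m ≤ h * D := by
    have h1 : T ^ 2 ≤ 2 * (β * h) ^ 2 + 2 * (γ * √(h / κ)) ^ 2 := by
      rw [hT]
      nlinarith [sq_nonneg (β * h - γ * √(h / κ))]
    have h2 : (γ * √(h / κ)) ^ 2 = γ ^ 2 * (h * A / μ) := by
      rw [mul_pow, Real.sq_sqrt (by positivity), hκ]
      field_simp
    have h3 : (β * h) ^ 2 = 16 * s ^ 2 := by rw [hβ]; field_simp; ring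
    rw [h2, h3] at h1
    calc T ^ 2 * A ^ m ≤ (2 * (16 * s ^ 2) + 2 * (γ ^ 2 * (h * A / μ))) * A ^ m := by gcongr
      _ = h * (32 * (s ^ 2 / h * A ^ m) + 2 / μ * (γ ^ 2 * A ^ (m + 1))) := by
          field_simp; ring
      _ ≤ h * D := by
          rw [hD]
          gcongr
          exact hpow (m + 1) (by omega)
  have hD0 : 0 < D := by rw [hD]; positivity
  have hAm : 1 ≤ A ^ m := one_le_pow₀ hA1
  have hTρ : T ≤ ρ := by
    have h1 : T ^ 2 ≤ T ^ 2 * A ^ m := le_mul_of_one_le_right (by positivity) hAm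
    have h2 : h * D ≤ D := mul_le_of_le_one_left hD0.le hh1.le
    exact le_of_sq_le_sq (by linarith) hρ.le
  have hbox1 : ∀ x ∈ closure (upperHalfBall m), u x ≤ h → κ * ‖horizontalPart x‖ ^ 2 ≤ h :=
    fun x hx hux => by simpa [hux] using hquad x hx
  obtain ⟨ε, hε, hlin⟩ := hu.exists_linear_le hμ hh hκ0 (div_le_self hμ.le hA1) hT0 hTρ hhμ hbox1
    (fun x hx hux => by
      have h1 := hcone x hx
      rw [max_eq_right hux] at h1
      have h2 : ‖horizontalPart x‖ ≤ √(h / κ) := by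
        apply Real.le_sqrt_of_sq_le
        rw [le_div_iff₀ hκ0, mul_comm]
        exact hbox1 x hx hux
      exact h1.trans (add_le_add le_rfl (mul_le_mul_of_nonneg_left h2 hγ0.le)))
    (by
      rw [hκ, div_pow, ← mul_div_assoc, lt_div_iff₀ (by positivity)]
      calc Λ * 2 ^ (m + 1) * T ^ 2 * A ^ m = Λ * 2 ^ (m + 1) * (T ^ 2 * A ^ m) := by ring
        _ ≤ Λ * 2 ^ (m + 1) * (h * D) := by gcongr
        _ = h * (Λ * 2 ^ (m + 1) * D) := by ring
        _ < h * μ ^ m := by gcongr)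
  obtain ⟨x, hx, hlt⟩ := hgrad ε hε
  exact absurd (hlin x hx) (not_le.2 hlt)

/-! ### Smallness conditions at small scales -/

open Filter Topology

theorem tendsto_const_mul_rpow_nhdsGT_zero (C : ℝ) {e : ℝ} (he : 0 < e) :
    Tendsto (fun s : ℝ => C * s ^ e) (𝓝[>] 0) (𝓝 0) := by
  have h : Tendsto (fun s : ℝ => s ^ e) (𝓝[>] 0) (𝓝 0) := by
    have := (Real.continuousAt_rpow_const 0 e (Or.inr he.le)).tendsto
    rw [Real.zero_rpow he.ne'] at this
    exact this.mono_left nhdsWithin_le_nhds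
  simpa using h.const_mul C

theorem two_mul_one_add_div_le {K θ s : ℝ} (hθ : 0 ≤ θ) (hs : 0 < s) (hs1 : s ≤ 1) :
    2 * (1 + K * (4 * s / s ^ (1 + θ))) ≤ 2 * (1 + 4 * K) * s ^ (-θ) := by
  have h1 : s / s ^ (1 + θ) = s ^ (-θ) := by
    rw [Real.rpow_add hs, Real.rpow_one, Real.rpow_neg hs.le]
    field_simp
  have h2 : (1 : ℝ) ≤ s ^ (-θ) := Real.one_le_rpow_of_pos_of_le_one_of_nonpos hs hs1 (by linarith)
  rw [mul_div_assoc, h1]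
  nlinarith

/-- The factor `2 (1 + 4 K s / s ^ (1 + θ))` is of order `s ^ (-θ)`, so a positive power of `s`
absorbs its `m`-th power for small `θ`. -/
theorem tendsto_sq_div_mul_pow {K θ : ℝ} (m : ℕ) (hK : 0 ≤ K) (hθ : 0 ≤ θ)
    (hmθ : (m + 1) * θ < 1) :
    Tendsto (fun s : ℝ => s ^ 2 / s ^ (1 + θ) * (2 * (1 + K * (4 * s / s ^ (1 + θ)))) ^ m)
      (𝓝[>] 0) (𝓝 0) := by
  have hev : ∀ᶠ s : ℝ in 𝓝[>] 0, 0 < s ∧ s ≤ 1 := by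
    filter_upwards [Ioo_mem_nhdsGT one_pos] with s hs using ⟨hs.1, hs.2.le⟩
  refine squeeze_zero' ?_ ?_ (tendsto_const_mul_rpow_nhdsGT_zero ((2 * (1 + 4 * K)) ^ m)
    (e := 1 - (m + 1) * θ) (by linarith))
  · filter_upwards [hev] with s hs
    have := hs.1
    positivity
  · filter_upwards [hev] with s hs
    have hs0 := hs.1
    have h1 : s ^ 2 / s ^ (1 + θ) = s ^ (1 - θ) := by
      rw [← Real.rpow_natCast, ← Real.rpow_sub hs0]
      congr 1
      push_cast
      ring
    calc s ^ 2 / s ^ (1 + θ) * (2 * (1 + K * (4 * s / s ^ (1 + θ)))) ^ m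
        ≤ s ^ (1 - θ) * (2 * (1 + 4 * K) * s ^ (-θ)) ^ m := by
          rw [h1]
          exact mul_le_mul_of_nonneg_left (pow_le_pow_left₀ (by positivity)
            (two_mul_one_add_div_le hθ hs0 hs.2) _) (by positivity)
      _ = (2 * (1 + 4 * K)) ^ m * s ^ (1 - (m + 1) * θ) := by
          rw [mul_pow, ← Real.rpow_mul_natCast hs0.le, mul_left_comm, ← Real.rpow_add hs0]
          congr 2
          ring

/-- The ratio of `s` to the radius of the disc on which `μ⁻¹ |x'| ^ (1 + α) ≤ s ^ (1 + θ)` absorbs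
a power of `s ^ (-θ)` for small `θ`. -/
theorem tendsto_sq_div_rpow_mul_pow {K θ μ α : ℝ} (k : ℕ) (hK : 0 ≤ K) (hθ : 0 ≤ θ) (hμ : 0 < μ)
    (hα : 0 < α) (hkθ : (k + 2) * θ < 2 * (α / (1 + α))) :
    Tendsto (fun s : ℝ => (4 * s / (μ * s ^ (1 + θ)) ^ (1 / (1 + α))) ^ 2 *
      (2 * (1 + K * (4 * s / s ^ (1 + θ)))) ^ k) (𝓝[>] 0) (𝓝 0) := by
  have hev : ∀ᶠ s : ℝ in 𝓝[>] 0, 0 < s ∧ s ≤ 1 := by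
    filter_upwards [Ioo_mem_nhdsGT one_pos] with s hs using ⟨hs.1, hs.2.le⟩
  have hα1 : 0 < 1 + α := by linarith
  set ω := 1 - (1 + θ) * (1 / (1 + α)) with hω
  have hωle : α / (1 + α) - θ ≤ ω := by
    have h1 : α / (1 + α) = 1 - 1 / (1 + α) := by field_simp; ring
    have h2 : θ * (1 / (1 + α)) ≤ θ :=
      mul_le_of_le_one_right hθ ((div_le_one hα1).2 (by linarith))
    rw [h1, hω]
    linarith
  set c := 4 / μ ^ (1 / (1 + α)) with hc
  refine squeeze_zero' ?_ ?_ (tendsto_const_mul_rpow_nhdsGT_zero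
    (c ^ 2 * (2 * (1 + 4 * K)) ^ k) (e := ω * 2 - θ * k) (by nlinarith))
  · filter_upwards [hev] with s hs
    have := hs.1
    positivity
  · filter_upwards [hev] with s hs
    have hs0 := hs.1
    have h1 : 4 * s / (μ * s ^ (1 + θ)) ^ (1 / (1 + α)) = c * s ^ ω := by
      rw [Real.mul_rpow hμ.le (by positivity), ← Real.rpow_mul hs0.le, hω, Real.rpow_sub hs0,
        Real.rpow_one, hc]
      field_simp
    calc (4 * s / (μ * s ^ (1 + θ)) ^ (1 / (1 + α))) ^ 2 *
          (2 * (1 + K * (4 * s / s ^ (1 + θ)))) ^ k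
        ≤ (c * s ^ ω) ^ 2 * (2 * (1 + 4 * K) * s ^ (-θ)) ^ k := by
          rw [h1]
          exact mul_le_mul_of_nonneg_left (pow_le_pow_left₀ (by positivity)
            (two_mul_one_add_div_le hθ hs0 hs.2) _) (by positivity)
      _ = c ^ 2 * (2 * (1 + 4 * K)) ^ k * s ^ (ω * 2 - θ * k) := by
          rw [mul_pow, mul_pow, ← Real.rpow_mul_natCast hs0.le, ← Real.rpow_mul_natCast hs0.le,
            mul_mul_mul_comm, ← Real.rpow_add hs0]
          congr 2
          push_cast
          ring

theorem theorem2p4 (m : ℕ) (α : ℝ) (hα : 1 / 5 < α) :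
    ∃ α' : ℝ, 0 < α' ∧
      ∀ lam Lam μ ρ : ℝ, 0 < lam → 0 < μ → 0 < ρ →
        ∃ c C : ℝ, 0 < c ∧ 0 < C ∧
          ∀ f φ u : EuclideanSpace ℝ (Fin (m + 1)) → ℝ,
            AEMeasurable f (volume.restrict (upperHalfBall m)) →
            (∀ᵐ x ∂(volume.restrict (upperHalfBall m)), lam ≤ f x ∧ f x ≤ Lam) →
            IsMongeAmpereSolution (upperHalfBall m) f φ u →
            u 0 = 0 →
            IsBoundaryGradient (upperHalfBall m) u 0 (EuclideanSpace.single (Fin.last m) 1) 0 →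
            (∀ x : EuclideanSpace ℝ (Fin (m + 1)), x (Fin.last m) = 0 →
              ‖horizontalPart x‖ < 1 / 2 → φ x ≤ μ⁻¹ * ‖horizontalPart x‖ ^ (1 + α)) →
            (∀ x ∈ frontier (upperHalfBall m), x (Fin.last m) ≤ ρ → μ * ‖x‖ ^ 2 ≤ φ x) →
            ∀ x ∈ upperHalfBall m, u x ≤ c → u x ≤ C * ‖x‖ ^ (1 + α') := by
  have hα0 : 0 < α := by linarith
  have hα1 : 0 < 1 + α := by linarith
  set τ := α / (1 + α) with hτ
  have hτ0 : 0 < τ := by positivity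
  have hτ1 : τ < 1 := (div_lt_one hα1).2 (by linarith)
  -- `θ` is so small that `2 (τ - θ) > (2 m + 4) θ` and `1 - θ > m θ`
  set θ := τ / (2 * m + 6) with hθ
  have hm : (0 : ℝ) < 2 * m + 6 := by positivity
  have hθ0 : 0 < θ := by positivity
  have hθτ : (2 * m + 6) * θ = τ := by rw [hθ]; field_simp
  refine ⟨θ, hθ0, fun lam Lam μ ρ _ hμ hρ => ?_⟩
  set Λ := max Lam 1 with hΛdef
  have hΛ : 0 < Λ := lt_max_of_lt_right one_pos
  obtain ⟨K, hK, hlow⟩ :=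
    IsSeparatedSupersolution.exists_quadratic_sub_linear_le m hΛ hμ hρ
  have hK0 : 0 < K := by linarith
  -- all smallness conditions hold at small scales
  have hXlim := tendsto_sq_div_rpow_mul_pow (2 * m + 4) hK0.le hθ0.le hμ hα0 (by
    push_cast; rw [← hτ]; nlinarith)
  have hYlim := tendsto_sq_div_mul_pow m hK0.le hθ0.le (by nlinarith)
  have hhlim := tendsto_const_mul_rpow_nhdsGT_zero 1 (e := 1 + θ) (by linarith)
  simp only [one_mul] at hhlim
  have hrlim : Tendsto (fun s : ℝ => (μ * s ^ (1 + θ)) ^ (1 / (1 + α))) (𝓝[>] 0) (𝓝 0) := by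
    have h1 := (Real.continuousAt_rpow_const 0 (1 / (1 + α)) (Or.inr (by positivity))).tendsto
    rw [Real.zero_rpow (by positivity)] at h1
    exact h1.comp (by simpa using hhlim.const_mul μ)
  have hDlim := (hYlim.const_mul 32).add (hXlim.const_mul (2 / μ))
  simp only [mul_zero, add_zero] at hDlim
  have hX2 := (hXlim.const_mul Λ).eventually_lt_const
    (show Λ * 0 < (μ / 4) ^ (m + 1) by rw [mul_zero]; positivity)
  have hX3 := (hXlim.const_mul ((2 * K / μ) ^ 2)).eventually_lt_const
    (show (2 * K / μ) ^ 2 * 0 < 1 by simp)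
  have hX4 := (hXlim.const_mul (2 * K / μ)).eventually_lt_const
    (show 2 * K / μ * 0 < ρ by simpa using hρ)
  have hD1 := (hDlim.const_mul (Λ * 2 ^ (m + 1))).eventually_lt_const
    (show Λ * 2 ^ (m + 1) * 0 < μ ^ m by rw [mul_zero]; positivity)
  have hev := (hXlim.eventually_lt_const one_pos).and <| hX2.and <| hX3.and <| hX4.and <|
    hD1.and <| (hDlim.eventually_lt_const (show 0 < ρ ^ 2 by positivity)).and <|
    (hhlim.eventually_lt_const one_pos).and <| (hhlim.eventually_lt_const hμ).and <|
    hrlim.eventually_lt_const (show (0 : ℝ) < 1 / 2 by norm_num)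
  obtain ⟨s₀, hs₀, hsmall⟩ := mem_nhdsGT_iff_exists_Ioo_subset.1
    (hev.and (Ioo_mem_nhdsGT one_pos))
  replace hs₀ : 0 < s₀ := hs₀
  refine ⟨1, max 1 (s₀ ^ (1 + θ))⁻¹, one_pos, by positivity, ?_⟩
  intro f φ u _ hf hsol hu0 hgrad hup hlo x hx hux
  have hΩo := isOpen_upperHalfBall m
  have hu : IsSeparatedSupersolution m Λ μ ρ u :=
    { convexOn := hsol.convexOn
      continuousOn := hsol.continuousOn
      volume_le := fun E hE hEΩ => by
        rw [hsol.volume_subdifferential E hE hEΩ]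
        calc ∫⁻ x in E, ENNReal.ofReal (f x) ≤ ∫⁻ _ in E, ENNReal.ofReal Λ := by
              refine lintegral_mono_ae ?_
              filter_upwards [ae_restrict_of_ae_restrict_of_subset hEΩ hf] with x hx
              exact ENNReal.ofReal_le_ofReal (hx.2.trans (le_max_left _ _))
          _ = ENNReal.ofReal Λ * volume E := by simp
      nonneg := fun x hx => by simpa [hu0] using hgrad.1 x hx
      zero := hu0
      le_of_notMem := fun x hx hn hxρ => by
        have hfr := mem_frontier_upperHalfBall hx hn
        rw [hsol.boundary x hfr]
        exact hlo x hfr hxρ }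
  have hgrad' : ∀ ε : ℝ, 0 < ε →
      ∃ x ∈ closure (upperHalfBall m), u x < ε * x (Fin.last m) := by
    intro ε hε
    have := hgrad.2 ε hε
    simp only [subdifferentialOn, Set.mem_ofPred_eq, not_forall, not_le] at this
    obtain ⟨x, hx, hlt⟩ := this
    refine ⟨x, hx, ?_⟩
    simpa [hu0, inner_smul_left, EuclideanSpace.inner_single_left] using hlt
  have hx0 : 0 < ‖x‖ := hx.2.trans_le (apply_last_le_norm x)
  have hpow : 0 < ‖x‖ ^ (1 + θ) := by positivity
  rcases lt_or_ge ‖x‖ s₀ with hlt | hge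
  · obtain ⟨⟨c1, c2, c3, c4, c5, c6, c7, c8, c9⟩, c10⟩ := hsmall ⟨hx0, hlt⟩
    have hr : 0 < (μ * ‖x‖ ^ (1 + θ)) ^ (1 / (1 + α)) := by positivity
    have hle : u x ≤ ‖x‖ ^ (1 + θ) := by
      refine hu.apply_le_of_flat_le hμ hρ hΛ hgrad' hK hpow hr hx0 (hlow u hu) ?_ rfl rfl rfl
        (by linarith) c7 c8 ?_ c1 c2 c3 c4 c5 c6 hx le_rfl
      · intro w hw
        have hw2 : ‖w‖ < 1 / 2 := hw.trans_lt c9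
        have hmem := ofHorizontal_zero_mem_closure (show ‖w‖ < 1 by linarith)
        rw [hsol.boundary _ (mem_frontier_upperHalfBall hmem fun h => by simpa using h.2)]
        refine (hup _ (by simp) (by simpa using hw2)).trans ?_
        rw [horizontalPart_ofHorizontal, inv_mul_le_iff₀ hμ]
        calc ‖w‖ ^ (1 + α) ≤ ((μ * ‖x‖ ^ (1 + θ)) ^ (1 / (1 + α))) ^ (1 + α) := by gcongr
          _ = μ * ‖x‖ ^ (1 + θ) := by
            rw [← Real.rpow_mul (by positivity), one_div_mul_cancel hα1.ne', Real.rpow_one]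
      · calc ‖x‖ ^ (1 + θ) ≤ ‖x‖ ^ (1 : ℝ) :=
              Real.rpow_le_rpow_of_exponent_ge hx0 c10.2.le (by linarith)
          _ = ‖x‖ := Real.rpow_one _
    exact hle.trans (le_mul_of_one_le_left hpow.le (le_max_left _ _))
  · have hs : 0 < s₀ ^ (1 + θ) := by positivity
    calc u x ≤ 1 := hux
      _ = (s₀ ^ (1 + θ))⁻¹ * s₀ ^ (1 + θ) := (inv_mul_cancel₀ hs.ne').symm
      _ ≤ max 1 (s₀ ^ (1 + θ))⁻¹ * ‖x‖ ^ (1 + θ) := by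
        gcongr
        exact le_max_right _ _
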